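/- Let $V$ be a second countable locally compact (Hausdorff) abelian group, written additively, with Pontryagin dual $\hat V$, and let $Q$ be a closed subgroup of the group $\mathrm{Aut}(V)$ of topological automorphisms of $V$, locally compact in the induced topology ($\mathrm{Aut}(V)$ carries the topology of uniform convergence on compact sets of $f$ and $f^{-1}$). For $q\in Q$ and $\xi\in\hat V$ put $q^\flat\xi:=\xi\circ q^{-1}$. Assume that there is $\xi_0\in\hat V$ for which the map $\phi:Q\to\hat V$, $\phi(q)=q^\flat\xi_0$, is an isomorphism of measure classes for the Haar measures of $Q$ and $\hat V$ (that is, up to null sets it is a Borel isomorphism preserving null sets in both directions). Let $H^2(Q,\mathbb T)$ be the measurable cohomology group: Borel functions $\omega:Q\times Q\to\mathbb T$ with $\omega(q_1,q_2)\,\omega(q_1q_2,q_3)=\omega(q_2,q_3)\,\omega(q_1,q_2q_3)$ for all $q_1,q_2,q_3$, modulo those of the form $u(q_1)u(q_2)/u(q_1q_2)$ with $u:Q\to\mathbb T$ Borel. Let $X:=Q\times\hat V$ with the measure class of the product of the Haar measures, and let $w:X\times X\to X\times X$ be given almost everywhere by $$w(q_1,\xi_1;q_2,\xi_2)=\big(q_2q_1,\;q_2^\flat\xi_1;\;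 r\,\phi^{-1}(\xi_0+\xi_1),\; r^\flat({q_2^{-1}}^\flat\xi_2-\xi_1)\big),\qquad r:=\phi^{-1}({q_2^{-1}}^\flat\xi_0+\xi_1)^{-1}.$$ A pentagonal $2$-cocycle is a measurable $\Theta:X\times X\to\mathbb T$ such that almost everywhere on $X\times X\times X$ $$\Theta_{12}\,(\Theta_{13}\circ w_{12})\,(\Theta_{23}\circ w_{13}\circ w_{12})=\Theta_{23}\,(\Theta_{12}\circ w_{23})$$ (equivalently, the operator $W_\Theta f:=\Theta\, d_w^{1/2}\,(f\circ w)$ on $L^2(X\times X)$, with $d_w$ the Radon–Nikodym derivative of $w$, satisfies the pentagonal equation, as $W_1$ does). It is trivial if $\Theta=\frac{a\otimes a}{(a\otimes a)\circ w}$ almost everywhere for some measurable $a:X\to\mathbb T$. Let $H^2(w,\mathbb T)$ be the group of pentagonal $2$-cocycles modulo the trivial ones. For a Borel $2$-cocycle $\omega$ on $Q$ define, almost everywhere, $$\Theta_\omega(q_1,\xi_1;q_2,\xi_2):=\omega\big(a,\,a^{-1}\phi^{-1}(\xi_0+{q_2^{-1}}^\flat\xi_2)\big)\;\overline{\omega}\big(b,\,b^{-1}\phi^{-1}(\xi_0+\xi_2)\big),$$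 where $a:=\phi^{-1}(\xi_0+\xi_1)$ and $b:=\phi^{-1}(\xi_0+q_2^\flat\xi_1)$. **Proposition.** Assume in addition that $\phi$ is open. Then each $\Theta_\omega$ is a pentagonal $2$-cocycle, and $[\omega]\mapsto[\Theta_\omega]$ is a well-defined group homomorphism $H^2(Q,\mathbb T)\to H^2(w,\mathbb T)$. If $\omega:Q\times Q\to\mathbb T$ is a continuous $2$-cocycle such that $[\Theta_\omega]=[1]$ in $H^2(w,\mathbb T)$, then $[\omega]=[1]$ in $H^2(Q,\mathbb T)$. Thus the homomorphism is injective on the set of those classes in $H^2(Q,\mathbb T)$ that are represented by continuous cocycles. -/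

import Mathlib

open MeasureTheory Measure

noncomputable section

/-! ### The topological group of automorphisms -/

section Aut

/-- The group `Aut(V)` of automorphisms of the topological group `V`, under composition. -/
instance autGroup {V : Type*} [CommGroup V] [TopologicalSpace V] : Group (V ≃ₜ* V) where
  mul f g := g.trans f
  one := ContinuousMulEquiv.refl V
  inv f := f.symm
  mul_assoc _ _ _ := rfl
  one_mul _ := rfl
  mul_one _ := rfl
  inv_mul_cancel f := by
    ext x
    exact f.symm_apply_apply x

/-- An automorphism and its inverse, as continuous maps. -/
def autToMaps {V : Type*} [CommGroup V] [TopologicalSpace V] (f : V ≃ₜ* V) : C(V, V) × C(V, V) :=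
  (⟨f, f.continuous_toFun⟩, ⟨f.symm, f.continuous_invFun⟩)

/-- The usual topology of `Aut(V)`: `f` is close to `g` if `f` is close to `g` and `f⁻¹` is close
to `g⁻¹`, uniformly on compact sets. -/
instance autTopology {V : Type*} [CommGroup V] [TopologicalSpace V] :
    TopologicalSpace (V ≃ₜ* V) :=
  TopologicalSpace.induced autToMaps inferInstance

instance aut_isTopologicalGroup {V : Type*} [CommGroup V] [TopologicalSpace V]
    [LocallyCompactSpace V] : IsTopologicalGroup (V ≃ₜ* V) where
  continuous_mul := by
    have h : Continuous (autToMaps (V := V)) := continuous_induced_dom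
    refine continuous_induced_rng.2 (Continuous.prodMk ?_ ?_)
    · exact (h.fst.comp continuous_fst).compCM (h.fst.comp continuous_snd)
    · exact (h.snd.comp continuous_snd).compCM (h.snd.comp continuous_fst)
  continuous_inv := by
    have h : Continuous (autToMaps (V := V)) := continuous_induced_dom
    exact continuous_induced_rng.2 (Continuous.prodMk h.snd h.fst)

instance aut_t2Space {V : Type*} [CommGroup V] [TopologicalSpace V] [T2Space V] :
    T2Space (V ≃ₜ* V) := by
  have hi : Function.Injective (autToMaps (V := V)) := by
    intro f g h
    ext x
    exact DFunLike.congr_fun (congrArg Prod.fst h) x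
  exact T2Space.of_injective_continuous hi continuous_induced_dom

instance aut_secondCountable {V : Type*} [CommGroup V] [TopologicalSpace V]
    [LocallyCompactSpace V] [SecondCountableTopology V] : SecondCountableTopology (V ≃ₜ* V) :=
  TopologicalSpace.secondCountableTopology_induced _ _ autToMaps

instance autMeasurableSpace {V : Type*} [CommGroup V] [TopologicalSpace V] :
    MeasurableSpace (V ≃ₜ* V) := borel _

instance aut_borelSpace {V : Type*} [CommGroup V] [TopologicalSpace V] :
    BorelSpace (V ≃ₜ* V) := ⟨rfl⟩

instance circleMeasurableSpace : MeasurableSpace Circle := borel _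

instance circle_borelSpace : BorelSpace Circle := ⟨rfl⟩

instance dualMeasurableSpace {V : Type*} [CommGroup V] [TopologicalSpace V] :
    MeasurableSpace (PontryaginDual V) := borel _

instance dual_borelSpace {V : Type*} [CommGroup V] [TopologicalSpace V] :
    BorelSpace (PontryaginDual V) := ⟨rfl⟩

end Aut

/-! ### Measure class isomorphisms -/

/-- `f` is an isomorphism of measure classes `(X, [μ]) → (Y, [ν])`: up to null sets it is a Borel
isomorphism, and it preserves null sets in both directions. -/
def IsMeasureClassIso {X Y : Type*} [MeasurableSpace X] [MeasurableSpace Y]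
    (μ : Measure X) (ν : Measure Y) (f : X → Y) : Prop :=
  QuasiMeasurePreserving f μ ν ∧
    ∃ g : Y → X, QuasiMeasurePreserving g ν μ ∧ g ∘ f =ᵐ[μ] id ∧ f ∘ g =ᵐ[ν] id

/-! ### Group cohomology in degree two, with coefficients in the circle -/

section GroupCohomology

/-- Borel `2`-cocycles `Q × Q → 𝕋` on the group `Q`. -/
def groupZ2 (Q : Type*) [Group Q] [MeasurableSpace Q] : Subgroup (Q × Q → Circle) where
  carrier := {ω | Measurable ω ∧
    ∀ q₁ q₂ q₃ : Q, ω (q₁, q₂) * ω (q₁ * q₂, q₃) = ω (q₂, q₃) * ω (q₁, q₂ * q₃)}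
  one_mem' := ⟨measurable_const, fun _ _ _ => by simp⟩
  mul_mem' := by
    rintro ω ω' ⟨h, h2⟩ ⟨h', h2'⟩
    refine ⟨h.mul h', fun a b c => ?_⟩
    simp only [Pi.mul_apply]
    rw [mul_mul_mul_comm, h2, h2', mul_mul_mul_comm]
  inv_mem' := by
    rintro ω ⟨h, h2⟩
    refine ⟨h.inv, fun a b c => ?_⟩
    simp only [Pi.inv_apply]
    rw [← mul_inv, h2, mul_inv]

/-- The trivial cocycles: `ω(q₁, q₂) = u(q₁) u(q₂) / u(q₁ q₂)` for some Borel `u : Q → 𝕋`. -/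
def groupB2 (Q : Type*) [Group Q] [MeasurableSpace Q] : Subgroup (Q × Q → Circle) where
  carrier := {ω | ∃ u : Q → Circle, Measurable u ∧
    ∀ q₁ q₂ : Q, ω (q₁, q₂) = u q₁ * u q₂ / u (q₁ * q₂)}
  one_mem' := ⟨1, measurable_const, fun _ _ => by simp⟩
  mul_mem' := by
    rintro ω ω' ⟨u, hu, h⟩ ⟨u', hu', h'⟩
    refine ⟨u * u', hu.mul hu', fun a b => ?_⟩
    simp only [Pi.mul_apply]
    rw [h, h', div_mul_div_comm, mul_mul_mul_comm]
  inv_mem' := by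
    rintro ω ⟨u, hu, h⟩
    refine ⟨u⁻¹, hu.inv, fun a b => ?_⟩
    simp only [Pi.inv_apply]
    rw [h, inv_div, div_eq_mul_inv, div_eq_mul_inv, inv_inv, mul_inv, mul_comm]

/-- The measurable cohomology group `H²(Q, 𝕋)`. -/
abbrev GroupH2 (Q : Type*) [Group Q] [MeasurableSpace Q] : Type _ :=
  groupZ2 Q ⧸ (groupB2 Q).subgroupOf (groupZ2 Q)

/-- The class `[ω] ∈ H²(Q, 𝕋)`. -/
def groupClass {Q : Type*} [Group Q] [MeasurableSpace Q] (ω : groupZ2 Q) : GroupH2 Q :=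
  QuotientGroup.mk ω

end GroupCohomology

/-! ### Pentagonal cohomology in degree two -/

section Pentagonal

/-- `w₁₂` on `X × X × X`. -/
def leg12 {X : Type*} (w : X × X → X × X) (t : X × X × X) : X × X × X :=
  ((w (t.1, t.2.1)).1, (w (t.1, t.2.1)).2, t.2.2)

/-- `w₁₃` on `X × X × X`. -/
def leg13 {X : Type*} (w : X × X → X × X) (t : X × X × X) : X × X × X :=
  ((w (t.1, t.2.2)).1, t.2.1, (w (t.1, t.2.2)).2)

/-- `w₂₃` on `X × X × X`. -/
def leg23 {X : Type*} (w : X × X → X × X) (t : X × X × X) : X × X × X :=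
  (t.1, w t.2)

/-- `Θ : X × X → 𝕋` is a pentagonal `2`-cocycle for `w` if it is measurable and almost everywhere
`Θ₁₂ (Θ₁₃ ∘ w₁₂) (Θ₂₃ ∘ w₁₃ ∘ w₁₂) = Θ₂₃ (Θ₁₂ ∘ w₂₃)`. This says that `W_Θ` satisfies the
pentagonal equation as `W_1` does: see `isPentagonalCocycle_iff` below. -/
def IsPentagonalCocycle {X : Type*} [MeasurableSpace X] (μ : Measure X) (w : X × X → X × X)
    (Θ : X × X → Circle) : Prop :=
  Measurable Θ ∧ ∀ᵐ t ∂(μ.prod (μ.prod μ)),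
    Θ (t.1, t.2.1) * Θ ((leg12 w t).1, (leg12 w t).2.2) * Θ (leg13 w (leg12 w t)).2
      = Θ t.2 * Θ ((leg23 w t).1, (leg23 w t).2.1)

/-- The group of pentagonal `2`-cocycles for `w`. -/
def pentagonalZ2 {X : Type*} [MeasurableSpace X] (μ : Measure X) (w : X × X → X × X) :
    Subgroup (X × X → Circle) where
  carrier := {Θ | IsPentagonalCocycle μ w Θ}
  one_mem' := ⟨measurable_const, by simp⟩
  mul_mem' := by
    rintro Θ Θ' ⟨h, h2⟩ ⟨h', h2'⟩
    refine ⟨h.mul h', ?_⟩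
    filter_upwards [h2, h2'] with t e e'
    simp only [Pi.mul_apply]
    rw [mul_mul_mul_comm (Θ t.2), ← e, ← e', mul_mul_mul_comm (Θ (t.1, t.2.1)),
      mul_mul_mul_comm (Θ (t.1, t.2.1) * _)]
  inv_mem' := by
    rintro Θ ⟨h, h2⟩
    refine ⟨h.inv, ?_⟩
    filter_upwards [h2] with t e
    simp only [Pi.inv_apply]
    rw [← mul_inv, ← mul_inv, e, mul_inv]

/-- The trivial pentagonal cocycles: `Θ = (a ⊗ a) / ((a ⊗ a) ∘ w)` almost everywhere, for some
measurable `a : X → 𝕋`. -/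
def pentagonalB2 {X : Type*} [MeasurableSpace X] (μ : Measure X) (w : X × X → X × X) :
    Subgroup (X × X → Circle) where
  carrier := {Θ | ∃ a : X → Circle, Measurable a ∧
    ∀ᵐ p ∂(μ.prod μ), Θ p = a p.1 * a p.2 / (a (w p).1 * a (w p).2)}
  one_mem' := ⟨1, measurable_const, by simp⟩
  mul_mem' := by
    rintro Θ Θ' ⟨a, ha, h⟩ ⟨a', ha', h'⟩
    refine ⟨a * a', ha.mul ha', ?_⟩
    filter_upwards [h, h'] with p e e'
    simp only [Pi.mul_apply]
    rw [e, e', div_mul_div_comm, mul_mul_mul_comm, mul_mul_mul_comm (a (w p).1)]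
  inv_mem' := by
    rintro Θ ⟨a, ha, h⟩
    refine ⟨a⁻¹, ha.inv, ?_⟩
    filter_upwards [h] with p e
    simp only [Pi.inv_apply]
    rw [e, inv_div, ← mul_inv, ← mul_inv, inv_div_inv]

/-- The pentagonal cohomology group `H²(w, 𝕋)`. (Cocycles that agree almost everywhere have the
same class.) -/
abbrev PentagonalH2 {X : Type*} [MeasurableSpace X] (μ : Measure X) (w : X × X → X × X) : Type _ :=
  pentagonalZ2 μ w ⧸ (pentagonalB2 μ w).subgroupOf (pentagonalZ2 μ w)

/-- The class `[Θ] ∈ H²(w, 𝕋)`. -/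
def pentagonalClass {X : Type*} [MeasurableSpace X] {μ : Measure X} {w : X × X → X × X}
    (Θ : pentagonalZ2 μ w) : PentagonalH2 μ w :=
  QuotientGroup.mk Θ

/-! The operators `W_Θ`, and what the cocycle identity means for them. -/

/-- The Radon–Nikodym derivative `d_w` of a measure class isomorphism `w` of `X × X`, determined by
`∫ (f ∘ w) d_w = ∫ f`. -/
def rnDerivOf {X : Type*} [MeasurableSpace X] (μ : Measure X) (w : X × X → X × X) (p : X × X) : ℝ :=
  ((((μ.prod μ).map w).rnDeriv (μ.prod μ)) (w p))⁻¹.toReal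

/-- The factor `Θ d_w^{1/2}` in `W_Θ f = Θ d_w^{1/2} (f ∘ w)`. -/
def unitaryFactor {X : Type*} [MeasurableSpace X] (μ : Measure X) (w : X × X → X × X)
    (Θ : X × X → Circle) (p : X × X) : ℂ :=
  (Θ p : ℂ) * (Real.sqrt (rnDerivOf μ w p) : ℂ)

/-- `(W_Θ)₁₂` acting on functions on `X × X × X`. -/
def opLeg12 {X : Type*} [MeasurableSpace X] (μ : Measure X) (w : X × X → X × X)
    (Θ : X × X → Circle) (f : X × X × X → ℂ) (t : X × X × X) : ℂ :=
  unitaryFactor μ w Θ (t.1, t.2.1) * f (leg12 w t)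

/-- `(W_Θ)₁₃` acting on functions on `X × X × X`. -/
def opLeg13 {X : Type*} [MeasurableSpace X] (μ : Measure X) (w : X × X → X × X)
    (Θ : X × X → Circle) (f : X × X × X → ℂ) (t : X × X × X) : ℂ :=
  unitaryFactor μ w Θ (t.1, t.2.2) * f (leg13 w t)

/-- `(W_Θ)₂₃` acting on functions on `X × X × X`. -/
def opLeg23 {X : Type*} [MeasurableSpace X] (μ : Measure X) (w : X × X → X × X)
    (Θ : X × X → Circle) (f : X × X × X → ℂ) (t : X × X × X) : ℂ :=
  unitaryFactor μ w Θ t.2 * f (leg23 w t)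

/-- The pentagonal equation `(W_Θ)₁₂ (W_Θ)₁₃ (W_Θ)₂₃ = (W_Θ)₂₃ (W_Θ)₁₂` on `L²(X × X × X)`. -/
def PentagonalEquation {X : Type*} [MeasurableSpace X] (μ : Measure X) (w : X × X → X × X)
    (Θ : X × X → Circle) : Prop :=
  ∀ f : X × X × X → ℂ, MemLp f 2 (μ.prod (μ.prod μ)) →
    opLeg12 μ w Θ (opLeg13 μ w Θ (opLeg23 μ w Θ f))
      =ᵐ[μ.prod (μ.prod μ)] opLeg23 μ w Θ (opLeg12 μ w Θ f)

theorem isMeasureClassIso_sigmaFinite_map {Y : Type*} [MeasurableSpace Y] {ν : Measure Y}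
    [SigmaFinite ν] {w : Y → Y} (hw : IsMeasureClassIso ν ν w) : SigmaFinite (ν.map w) := by
  obtain ⟨hq, g, hg, hgw, -⟩ := hw
  have hS : ∀ n, ν.map w (g ⁻¹' spanningSets ν n) < ⊤ := by
    intro n
    have hm : MeasurableSet (g ⁻¹' spanningSets ν n) :=
      hg.measurable (measurableSet_spanningSets ν n)
    rw [Measure.map_apply hq.measurable hm]
    refine lt_of_eq_of_lt (measure_congr ?_) (measure_spanningSets_lt_top ν n)
    filter_upwards [hgw] with x hx
    have hx' : g (w x) = x := hx
    change (g (w x) ∈ spanningSets ν n) = (x ∈ spanningSets ν n)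
    rw [hx']
  exact ⟨⟨⟨fun n => g ⁻¹' spanningSets ν n, fun _ => trivial, hS, by
    rw [← Set.preimage_iUnion, iUnion_spanningSets, Set.preimage_univ]⟩⟩⟩

theorem rnDerivOf_ae_pos {X : Type*} [MeasurableSpace X] {μ : Measure X} [SigmaFinite μ]
    {w : X × X → X × X} (hw : IsMeasureClassIso (μ.prod μ) (μ.prod μ) w) :
    ∀ᵐ p ∂(μ.prod μ), 0 < rnDerivOf μ w p := by
  have := isMeasureClassIso_sigmaFinite_map hw
  have hac : (μ.prod μ).map w ≪ μ.prod μ := hw.1.absolutelyContinuous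
  have h1 := ae_of_ae_map hw.1.measurable.aemeasurable (Measure.rnDeriv_pos hac)
  have h2 := hw.1.ae (Measure.rnDeriv_lt_top ((μ.prod μ).map w) (μ.prod μ))
  filter_upwards [h1, h2] with p a b
  exact ENNReal.toReal_pos (ENNReal.inv_ne_zero.2 b.ne) (ENNReal.inv_ne_top.2 a.ne')

/-- If `w` is a measure class isomorphism and `W = W_1` satisfies the pentagonal equation, then the
pentagonal `2`-cocycles are exactly the measurable `Θ` such that `W_Θ` still satisfies it. -/
theorem isPentagonalCocycle_iff {X : Type*} [MeasurableSpace X] {μ : Measure X} [SigmaFinite μ]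
    {w : X × X → X × X} (hw : IsMeasureClassIso (μ.prod μ) (μ.prod μ) w)
    (h1 : PentagonalEquation μ w 1) (Θ : X × X → Circle) :
    IsPentagonalCocycle μ w Θ ↔ Measurable Θ ∧ PentagonalEquation μ w Θ := by
  refine and_congr_right fun _ => ?_
  have hL : ∀ f t, opLeg12 μ w Θ (opLeg13 μ w Θ (opLeg23 μ w Θ f)) t
      = ((Θ (t.1, t.2.1) * Θ ((leg12 w t).1, (leg12 w t).2.2) * Θ (leg13 w (leg12 w t)).2 :
        Circle) : ℂ) * opLeg12 μ w 1 (opLeg13 μ w 1 (opLeg23 μ w 1 f)) t := by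
    intro f t
    simp only [opLeg12, opLeg13, opLeg23, unitaryFactor, Circle.coe_mul, Pi.one_apply,
      Circle.coe_one]
    ring
  have hR : ∀ f t, opLeg23 μ w Θ (opLeg12 μ w Θ f) t
      = ((Θ t.2 * Θ ((leg23 w t).1, (leg23 w t).2.1) : Circle) : ℂ)
        * opLeg23 μ w 1 (opLeg12 μ w 1 f) t := by
    intro f t
    simp only [opLeg12, opLeg23, unitaryFactor, Circle.coe_mul, Pi.one_apply, Circle.coe_one]
    ring
  constructor
  · intro h f hf
    filter_upwards [h, h1 f hf] with t a b
    rw [hL, hR, a, b]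
  · intro h
    -- an everywhere positive function in `L²`
    obtain ⟨g, hg0, hgm, hg⟩ := exists_pos_lintegral_lt_of_sigmaFinite (μ.prod (μ.prod μ))
      (ε := 1) one_ne_zero
    let f : X × X × X → ℂ := fun t => (Real.sqrt (g t) : ℂ)
    have hfm : Measurable f := by fun_prop
    have hf : MemLp f 2 (μ.prod (μ.prod μ)) := by
      rw [← memLp_norm_iff hfm.aestronglyMeasurable,
        memLp_two_iff_integrable_sq hfm.norm.aestronglyMeasurable]
      have he : (fun t => ‖f t‖ ^ 2) = fun t => (g t : ℝ) := by
        funext t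
        simp [f, Real.sq_sqrt]
      rw [he]
      refine ⟨by fun_prop, ?_⟩
      refine lt_of_le_of_lt (le_of_eq ?_) (hg.trans ENNReal.one_lt_top)
      simp [enorm_eq_nnnorm]
    have hd := rnDerivOf_ae_pos hw
    have q12 : QuasiMeasurePreserving (fun t : X × X × X => (t.1, t.2.1))
        (μ.prod (μ.prod μ)) (μ.prod μ) :=
      MeasureTheory.QuasiMeasurePreserving.prodMap (QuasiMeasurePreserving.id μ) quasiMeasurePreserving_fst
    have q13 : QuasiMeasurePreserving (fun t : X × X × X => (t.1, t.2.2))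
        (μ.prod (μ.prod μ)) (μ.prod μ) :=
      MeasureTheory.QuasiMeasurePreserving.prodMap (QuasiMeasurePreserving.id μ) quasiMeasurePreserving_snd
    have q23 : QuasiMeasurePreserving (fun t : X × X × X => t.2)
        (μ.prod (μ.prod μ)) (μ.prod μ) := quasiMeasurePreserving_snd
    have l12 : QuasiMeasurePreserving (leg12 w) (μ.prod (μ.prod μ)) (μ.prod (μ.prod μ)) :=
      (measurePreserving_prodAssoc μ μ μ).quasiMeasurePreserving.comp
        ((MeasureTheory.QuasiMeasurePreserving.prodMap hw.1 (QuasiMeasurePreserving.id μ)).comp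
          ((measurePreserving_prodAssoc μ μ μ).symm _).quasiMeasurePreserving)
    have hs : QuasiMeasurePreserving (fun t : X × X × X => (t.1, t.2.swap))
        (μ.prod (μ.prod μ)) (μ.prod (μ.prod μ)) :=
      MeasureTheory.QuasiMeasurePreserving.prodMap (QuasiMeasurePreserving.id μ)
        (Measure.measurePreserving_swap (μ := μ) (ν := μ)).quasiMeasurePreserving
    have l13 : QuasiMeasurePreserving (leg13 w) (μ.prod (μ.prod μ)) (μ.prod (μ.prod μ)) :=
      hs.comp (l12.comp hs)
    filter_upwards [h f hf, h1 f hf, q12.ae hd, l12.ae (q13.ae hd),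
      l12.ae (l13.ae (q23.ae hd))] with t a b d1 d2 d3
    rw [hL, hR, ← b] at a
    have hne : opLeg12 μ w 1 (opLeg13 μ w 1 (opLeg23 μ w 1 f)) t ≠ 0 := by
      have hgt := hg0 (leg23 w (leg13 w (leg12 w t)))
      simp only [opLeg12, opLeg13, opLeg23, unitaryFactor, Pi.one_apply, Circle.coe_one, one_mul, f]
      refine mul_ne_zero ?_ (mul_ne_zero ?_ (mul_ne_zero ?_ ?_)) <;>
        refine Complex.ofReal_ne_zero.2 (Real.sqrt_pos.2 ?_).ne'
      · exact d1
      · exact d2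
      · exact d3
      · exact_mod_cast hgt
    exact Circle.ext (mul_right_cancel₀ hne a)

end Pentagonal

/-! ### The dual orbit, the pentagonal transformation and the cocycles `Θ_ω`

The abelian groups `V` and `V̂` are written multiplicatively, so that `ξ₀ + ξ` becomes `ξ₀ * ξ` and
`ξ - η` becomes `ξ / η`. -/

section DualOrbit

/-- The dual action `q^♭ ξ = ξ ∘ q⁻¹` of `q ∈ Aut(V)` on `ξ ∈ V̂`. -/
def dualAct {V : Type*} [CommGroup V] [TopologicalSpace V] (q : V ≃ₜ* V) (ξ : PontryaginDual V) :
    PontryaginDual V :=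
  PontryaginDual.map (ContinuousMonoidHom.toContinuousMonoidHom q⁻¹) ξ

theorem dualAct_apply {V : Type*} [CommGroup V] [TopologicalSpace V] (q : V ≃ₜ* V)
    (ξ : PontryaginDual V) (v : V) : dualAct q ξ v = ξ (q⁻¹ v) := rfl

/-- The map `φ : Q → V̂`, `q ↦ q^♭ ξ₀`. -/
def orbitMap {V : Type*} [CommGroup V] [TopologicalSpace V] (Q : Subgroup (V ≃ₜ* V))
    (ξ₀ : PontryaginDual V) (q : Q) : PontryaginDual V :=
  dualAct (q : V ≃ₜ* V) ξ₀

/-- The inverse of `φ` on the orbit `φ(Q)`, with arbitrary values elsewhere. -/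
def orbitInv {V : Type*} [CommGroup V] [TopologicalSpace V] (Q : Subgroup (V ≃ₜ* V))
    (ξ₀ : PontryaginDual V) : PontryaginDual V → Q :=
  Function.invFun (orbitMap Q ξ₀)

/-- The pentagonal transformation `w` of `Q × V̂`. -/
def pentagonalMap {V : Type*} [CommGroup V] [TopologicalSpace V] (Q : Subgroup (V ≃ₜ* V))
    (ξ₀ : PontryaginDual V) (p : (Q × PontryaginDual V) × (Q × PontryaginDual V)) :
    (Q × PontryaginDual V) × (Q × PontryaginDual V) :=
  let q₁ := p.1.1
  let ξ₁ := p.1.2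
  let q₂ := p.2.1
  let ξ₂ := p.2.2
  let r : Q := (orbitInv Q ξ₀ (dualAct ((q₂⁻¹ : Q) : V ≃ₜ* V) ξ₀ * ξ₁))⁻¹
  ((q₂ * q₁, dualAct (q₂ : V ≃ₜ* V) ξ₁),
    (r * orbitInv Q ξ₀ (ξ₀ * ξ₁),
      dualAct (r : V ≃ₜ* V) (dualAct ((q₂⁻¹ : Q) : V ≃ₜ* V) ξ₂ / ξ₁)))

/-- The function `Θ_ω` on `(Q × V̂) × (Q × V̂)`. -/
def pentagonalCocycle {V : Type*} [CommGroup V] [TopologicalSpace V] (Q : Subgroup (V ≃ₜ* V))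
    (ξ₀ : PontryaginDual V) (ω : Q × Q → Circle)
    (p : (Q × PontryaginDual V) × (Q × PontryaginDual V)) : Circle :=
  let ξ₁ := p.1.2
  let q₂ := p.2.1
  let ξ₂ := p.2.2
  let a : Q := orbitInv Q ξ₀ (ξ₀ * ξ₁)
  let b : Q := orbitInv Q ξ₀ (ξ₀ * dualAct (q₂ : V ≃ₜ* V) ξ₁)
  ω (a, a⁻¹ * orbitInv Q ξ₀ (ξ₀ * dualAct ((q₂⁻¹ : Q) : V ≃ₜ* V) ξ₂)) *
    (ω (b, b⁻¹ * orbitInv Q ξ₀ (ξ₀ * ξ₂)))⁻¹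

/-- The product of the Haar measures on `Q × V̂`. Only its class matters. -/
def dualHaar {V : Type*} [CommGroup V] [TopologicalSpace V] [IsTopologicalGroup V]
    [LocallyCompactSpace V] (Q : Subgroup (V ≃ₜ* V)) [LocallyCompactSpace Q] :
    Measure (Q × PontryaginDual V) :=
  (haar : Measure Q).prod (haar : Measure (PontryaginDual V))

end DualOrbit

end

/-! Let s be the inverse of the orbit map, and put F(ξ, η) = ω(x, x⁻¹y) where xξ₀ = ξ₀ξ and yξ₀ =
ξ₀η (`orbitCochain`). Then Θ_ω(q₁, ξ₁; q₂, ξ₂) = F(ξ₁, q₂⁻¹ξ₂) / F(q₂ξ₁, ξ₂) measures how far F is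
from being invariant under Q. The cocycle identity of ω turns into F(ξ, η) F(η, ζ) = F(x⁻¹(η/ξ),
x⁻¹(ζ/ξ)) F(ξ, ζ) (`orbitCochain_mul`), and the pentagonal identity is the quotient of two instances
of it.

For the kernel, let Θ_ω be the coboundary of a. Neither Θ_ω nor the second leg of w involves q₁, and
this forces a(q, ξ) = f(s(ξ)⁻¹q) g(s(ξ)) (`exists_factorization`). Dividing ω by the coboundary of a
suitable u absorbs g, so that a(q, ξ) becomes a function of q⁻¹ξ alone. The first leg of w preserves
q⁻¹ξ, and what is left of the coboundary equation says that F(qξ, qη) does not depend on q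
(`orbitCochain_smul_of_coboundary`): F is invariant.

The factor x⁻¹ then disappears from the identity for F, and N(t) = F(xξ₀, xtξ₀) does not depend on
x. At the points xξ₀, xpξ₀, xptξ₀ the identity reads N(p) N(t) = ω(p, t) N(pt), so ω is a coboundary
almost everywhere, hence everywhere after a change of the cochain (`mem_groupB2_of_ae`). -/

set_option linter.unusedSectionVars false

/-! ### Null sets under skew products. -/

section SkewProduct

variable {α β γ δ : Type*} [MeasurableSpace α] [MeasurableSpace β] [MeasurableSpace γ]
  [MeasurableSpace δ] {μ : Measure α} {ν : Measure β} {τ : Measure γ} {σ : Measure δ}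

theorem quasiMeasurePreserving_skew [SFinite ν] [SFinite σ] {f : α → γ} {g : α → β → δ}
    (hf : QuasiMeasurePreserving f μ τ) (hgm : Measurable fun p : α × β => g p.1 p.2)
    (hg : ∀ a, QuasiMeasurePreserving (g a) ν σ) :
    QuasiMeasurePreserving (fun p : α × β => (f p.1, g p.1 p.2)) (μ.prod ν) (τ.prod σ) := by
  have hm : Measurable fun p : α × β => (f p.1, g p.1 p.2) :=
    (hf.measurable.comp measurable_fst).prodMk hgm
  refine ⟨hm, AbsolutelyContinuous.mk fun t ht h0 => ?_⟩
  rw [map_apply hm ht, measure_prod_null (hm ht)]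
  filter_upwards [hf.ae ((measure_prod_null ht).1 h0)] with a ha
  exact (hg a).preimage_null ha

variable [SFinite μ] [SFinite ν] [SFinite τ] [SFinite σ]

theorem quasiMeasurePreserving_swap :
    QuasiMeasurePreserving (Prod.swap : α × β → β × α) (μ.prod ν) (ν.prod μ) :=
  measurePreserving_swap.quasiMeasurePreserving

theorem quasiMeasurePreserving_skew_left {f : β → δ} {g : α → β → γ}
    (hf : QuasiMeasurePreserving f ν σ) (hgm : Measurable fun p : α × β => g p.1 p.2)
    (hg : ∀ b, QuasiMeasurePreserving (fun a => g a b) μ τ) :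
    QuasiMeasurePreserving (fun p : α × β => (g p.1 p.2, f p.2)) (μ.prod ν) (τ.prod σ) :=
  quasiMeasurePreserving_swap.comp ((quasiMeasurePreserving_skew (g := fun b a => g a b) hf
    (hgm.comp measurable_swap) hg).comp quasiMeasurePreserving_swap)

theorem quasiMeasurePreserving_leftComm :
    QuasiMeasurePreserving (fun p : α × β × γ => (p.2.1, p.1, p.2.2))
      (μ.prod (ν.prod τ)) (ν.prod (μ.prod τ)) :=
  (measurePreserving_prodAssoc ν μ τ).quasiMeasurePreserving.comp
    ((MeasureTheory.QuasiMeasurePreserving.prodMap quasiMeasurePreserving_swap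
      (QuasiMeasurePreserving.id τ)).comp
      ((measurePreserving_prodAssoc μ ν τ).symm _).quasiMeasurePreserving)

end SkewProduct

/-! ### From almost everywhere coboundaries to coboundaries. -/

section AlmostEverywhereCocycle

variable {Q : Type*} [Group Q] [MeasurableSpace Q]

theorem groupB2_le_groupZ2 [MeasurableMul₂ Q] : groupB2 Q ≤ groupZ2 Q := by
  rintro ω ⟨u, hu, h⟩
  refine ⟨?_, fun a b c => ?_⟩
  · have : ω = fun p => u p.1 * u p.2 / u (p.1 * p.2) := funext fun p => h p.1 p.2
    rw [this]
    exact ((hu.comp measurable_fst).mul (hu.comp measurable_snd)).div (hu.comp measurable_mul)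
  · simp only [h, mul_assoc a b c, div_mul_div_comm, div_eq_div_iff_mul_eq_mul]
    generalize u (a * b) = r, u (b * c) = s, u (a * (b * c)) = t
    ac_rfl

theorem measurable_circle_iff {α : Type*} [MeasurableSpace α] {f : α → Circle} :
    Measurable f ↔ Measurable fun x => (f x : ℂ) := by
  have hc : Continuous fun z : Circle => (z : ℂ) := by fun_prop
  have h := (hc.isClosedEmbedding Circle.coe_injective).measurableEmbedding
  exact h.measurable_comp_iff.symm

variable [MeasurableMul₂ Q] [MeasurableInv Q] {μ : Measure Q} [SFinite μ] [μ.IsMulLeftInvariant]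
  [NeZero μ]

/-- The cocycle identity at (x, y, z), with x generic, shows that for every y the function ω(y, ·)
is almost everywhere a constant v(y). The identity at (a, b, z), with z generic, then makes ω the
coboundary of v. -/
theorem mem_groupB2_of_ae_eq_one {ω : Q × Q → Circle} (hω : ω ∈ groupZ2 Q)
    (h : ∀ᵐ p ∂(μ.prod μ), ω p = 1) : ω ∈ groupB2 Q := by
  have h1 : ∀ᵐ x ∂μ, ∀ᵐ z ∂μ, ω (x, z) = 1 := ae_ae_of_ae_prod h
  have hconst : ∀ y, ∃ c : Circle, ∀ᵐ z ∂μ, ω (y, z) = c := by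
    intro y
    obtain ⟨x, hx, hxy⟩ := (h1.and ((quasiMeasurePreserving_mul_right μ y).ae h1)).exists
    refine ⟨ω (x, y), ?_⟩
    filter_upwards [hxy, (measurePreserving_mul_left μ y).quasiMeasurePreserving.ae hx]
      with z e1 e2
    have := hω.2 x y z
    rw [e1, e2, mul_one, mul_one] at this
    exact this.symm
  choose v hv using hconst
  refine ⟨v, ?_, fun a b => ?_⟩
  -- Averaging over z against a probability measure with the same null sets recovers v, which is
  -- therefore Borel.
  · have hm : StronglyMeasurable fun y => ∫ z, (ω (y, z) : ℂ) ∂μ.toFinite :=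
      (measurable_circle_iff.1 hω.1).stronglyMeasurable.integral_prod_right'
    have he : ∀ y, ∫ z, (ω (y, z) : ℂ) ∂μ.toFinite = v y := by
      intro y
      have : ∀ᵐ z ∂μ.toFinite, (ω (y, z) : ℂ) = v y :=
        (toFinite_absolutelyContinuous μ).ae_le ((hv y).mono fun z hz => by rw [hz])
      rw [integral_congr_ae this]
      simp
    rw [measurable_circle_iff]
    simpa only [he] using hm.measurable
  · obtain ⟨z, e1, e2, e3⟩ := ((hv (a * b)).and ((hv b).and
      ((measurePreserving_mul_left μ b).quasiMeasurePreserving.ae (hv a)))).exists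
    have := hω.2 a b z
    rw [e1, e2, e3] at this
    rw [eq_div_iff_mul_eq', this, mul_comm]

theorem mem_groupB2_of_ae {ω : Q × Q → Circle} (hω : ω ∈ groupZ2 Q) {e : Q → Circle}
    (he : Measurable e)
    (h : ∀ᵐ p ∂(μ.prod μ), ω p = e p.1 * e p.2 / e (p.1 * p.2)) : ω ∈ groupB2 Q := by
  have hB : (fun p : Q × Q => e p.1 * e p.2 / e (p.1 * p.2)) ∈ groupB2 Q := ⟨e, he, fun _ _ => rfl⟩
  rw [← (groupB2 Q).mul_mem_cancel_right ((groupB2 Q).inv_mem hB)]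
  refine mem_groupB2_of_ae_eq_one (μ := μ)
    ((groupZ2 Q).mul_mem hω ((groupZ2 Q).inv_mem (groupB2_le_groupZ2 hB))) ?_
  filter_upwards [h] with p hp
  simp only [Pi.mul_apply, Pi.inv_apply, hp, mul_inv_cancel]

end AlmostEverywhereCocycle

/-! ### Pointwise identities for a free orbit. -/

section FreeOrbit

variable {G A : Type*} [Group G] [CommGroup A] [MulDistribMulAction G A]

/-- The pentagonal transformation attached to an action of `G` on `A`, a point `ξ₀ : A`, and an
inverse `s` of the orbit map `g ↦ g • ξ₀`. -/
def orbitPentagon (ξ₀ : A) (s : A → G) (p : (G × A) × (G × A)) : (G × A) × (G × A) :=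
  ((p.2.1 * p.1.1, p.2.1 • p.1.2),
    ((s (p.2.1⁻¹ • ξ₀ * p.1.2))⁻¹ * s (ξ₀ * p.1.2),
      (s (p.2.1⁻¹ • ξ₀ * p.1.2))⁻¹ • (p.2.1⁻¹ • p.2.2 / p.1.2)))

/-- The function `(ξ, η) ↦ ω(x, x⁻¹y)`, where `x ξ₀ = ξ₀ ξ` and `y ξ₀ = ξ₀ η`. -/
noncomputable def orbitCochain (ξ₀ : A) (s : A → G) (ω : G × G → Circle) (ξ η : A) : Circle :=
  ω (s (ξ₀ * ξ), (s (ξ₀ * ξ))⁻¹ * s (ξ₀ * η))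

/-- The pentagonal cocycle attached to the group cocycle `ω`. -/
noncomputable def orbitCocycle (ξ₀ : A) (s : A → G) (ω : G × G → Circle) (p : (G × A) × (G × A)) : Circle :=
  orbitCochain ξ₀ s ω p.1.2 (p.2.1⁻¹ • p.2.2) *
    (orbitCochain ξ₀ s ω (p.2.1 • p.1.2) p.2.2)⁻¹

/-- `s` inverts the orbit map at the point `ξ₀ ξ`. -/
def InShiftedOrbit (ξ₀ : A) (s : A → G) (ξ : A) : Prop :=
  s (ξ₀ * ξ) • ξ₀ = ξ₀ * ξ

section Algebra

variable {ξ₀ : A} {s : A → G} {ω : G × G → Circle}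

theorem orbitInverse_smul (hs : ∀ g : G, s (g • ξ₀) = g) (g : G) {ζ : A} (hζ : s ζ • ξ₀ = ζ) :
    s (g • ζ) = g * s ζ := by
  conv_lhs => rw [← hζ, smul_smul, hs]

theorem shift_smul_div {ξ : A} (hξ : InShiftedOrbit ξ₀ s ξ) (η : A) :
    ξ₀ * (s (ξ₀ * ξ))⁻¹ • (η / ξ) = (s (ξ₀ * ξ))⁻¹ • (ξ₀ * η) := by
  have h : (s (ξ₀ * ξ))⁻¹ • (ξ₀ * ξ) = ξ₀ := inv_smul_eq_iff.2 hξ.symm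
  rw [show ξ₀ * η = ξ₀ * ξ * (η / ξ) by rw [mul_assoc, mul_div_cancel], smul_mul', h]

theorem orbitInverse_shift_smul_div (hs : ∀ g : G, s (g • ξ₀) = g) {ξ η : A}
    (hξ : InShiftedOrbit ξ₀ s ξ) (hη : InShiftedOrbit ξ₀ s η) :
    s (ξ₀ * (s (ξ₀ * ξ))⁻¹ • (η / ξ)) = (s (ξ₀ * ξ))⁻¹ * s (ξ₀ * η) := by
  rw [shift_smul_div hξ, orbitInverse_smul hs _ hη]

theorem orbitCochain_mul (hs : ∀ g : G, s (g • ξ₀) = g) {ω : G × G → Circle}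
    (hω : ∀ a b c : G, ω (a, b) * ω (a * b, c) = ω (b, c) * ω (a, b * c)) {ξ η ζ : A}
    (hξ : InShiftedOrbit ξ₀ s ξ) (hη : InShiftedOrbit ξ₀ s η) (hζ : InShiftedOrbit ξ₀ s ζ) :
    orbitCochain ξ₀ s ω ξ η * orbitCochain ξ₀ s ω η ζ =
      orbitCochain ξ₀ s ω ((s (ξ₀ * ξ))⁻¹ • (η / ξ)) ((s (ξ₀ * ξ))⁻¹ • (ζ / ξ)) *
        orbitCochain ξ₀ s ω ξ ζ := by
  simp only [orbitCochain, orbitInverse_shift_smul_div hs hξ hη,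
    orbitInverse_shift_smul_div hs hξ hζ]
  have := hω (s (ξ₀ * ξ)) ((s (ξ₀ * ξ))⁻¹ * s (ξ₀ * η)) ((s (ξ₀ * η))⁻¹ * s (ξ₀ * ζ))
  simpa [mul_assoc] using this

/-- Equivariance of s replaces the base point q₂⁻¹ξ₀ · ξ₁ by ξ₀ · q₂ξ₁, the form in which
`orbitInverse_shift_smul_div` applies. -/
theorem orbitPentagon_eq (hs : ∀ g : G, s (g • ξ₀) = g) {p : (G × A) × (G × A)}
    (hp : InShiftedOrbit ξ₀ s (p.2.1 • p.1.2)) :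
    orbitPentagon ξ₀ s p = ((p.2.1 * p.1.1, p.2.1 • p.1.2),
      ((s (ξ₀ * p.2.1 • p.1.2))⁻¹ * (p.2.1 * s (ξ₀ * p.1.2)),
        (s (ξ₀ * p.2.1 • p.1.2))⁻¹ • (p.2.2 / p.2.1 • p.1.2))) := by
  have h : s (p.2.1⁻¹ • ξ₀ * p.1.2) = p.2.1⁻¹ * s (ξ₀ * p.2.1 • p.1.2) := by
    rw [← orbitInverse_smul hs _ hp, smul_mul', inv_smul_smul]
  simp only [orbitPentagon, h, mul_inv_rev, inv_inv, mul_assoc, mul_smul, smul_div', smul_inv_smul]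

theorem orbitCocycle_pentagon (hs : ∀ g : G, s (g • ξ₀) = g)
    (hω : ∀ a b c : G, ω (a, b) * ω (a * b, c) = ω (b, c) * ω (a, b * c))
    {t : (G × A) × (G × A) × (G × A)}
    (h₁ : InShiftedOrbit ξ₀ s (t.2.1.1 • t.1.2)) (h₂ : InShiftedOrbit ξ₀ s t.2.1.2)
    (h₃ : InShiftedOrbit ξ₀ s (t.2.2.1⁻¹ • t.2.2.2))
    (h₄ : InShiftedOrbit ξ₀ s (t.2.2.1 • t.2.1.1 • t.1.2))
    (h₅ : InShiftedOrbit ξ₀ s (t.2.2.1 • t.2.1.2)) (h₆ : InShiftedOrbit ξ₀ s t.2.2.2) :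
    orbitCocycle ξ₀ s ω (t.1, t.2.1) *
        orbitCocycle ξ₀ s ω ((leg12 (orbitPentagon ξ₀ s) t).1,
          (leg12 (orbitPentagon ξ₀ s) t).2.2) *
        orbitCocycle ξ₀ s ω (leg13 (orbitPentagon ξ₀ s) (leg12 (orbitPentagon ξ₀ s) t)).2 =
      orbitCocycle ξ₀ s ω t.2 * orbitCocycle ξ₀ s ω ((leg23 (orbitPentagon ξ₀ s) t).1,
        (leg23 (orbitPentagon ξ₀ s) t).2.1) := by
  obtain ⟨⟨q₁, ξ₁⟩, ⟨q₂, ξ₂⟩, ⟨q₃, ξ₃⟩⟩ := t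
  dsimp only at h₁ h₂ h₃ h₄ h₅ h₆
  -- The second triple is q₃ times the first. The pentagonal identity is the quotient of these two
  -- relations, since the factor F(ξ₁, q₂⁻¹ξ₂) occurs on both of its sides.
  have e₁ := orbitCochain_mul hs hω h₁ h₂ h₃
  have e₂ := orbitCochain_mul hs hω h₄ h₅ h₆
  have w₁ := orbitPentagon_eq (p := ((q₁, ξ₁), (q₂, ξ₂))) hs h₁
  have w₂ := orbitPentagon_eq (p := ((q₂ * q₁, q₂ • ξ₁), (q₃, ξ₃))) hs h₄
  have w₃ : (orbitPentagon ξ₀ s ((q₂, ξ₂), (q₃, ξ₃))).1 = (q₃ * q₂, q₃ • ξ₂) := rfl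
  simp only [leg12, leg13, leg23, w₁, w₂, w₃, orbitCocycle]
  simp only [mul_inv_rev, inv_inv, mul_smul, smul_div', smul_inv_smul, inv_smul_smul] at e₁ e₂ ⊢
  rw [← eq_div_iff_mul_eq', eq_comm] at e₁ e₂
  rw [← e₁, ← e₂]
  apply Additive.ofMul.injective
  simp only [ofMul_mul, ofMul_inv, ofMul_div]
  abel

theorem orbitCocycle_coboundary (hs : ∀ g : G, s (g • ξ₀) = g) {u : G → Circle}
    (hω : ∀ a b : G, ω (a, b) = u a * u b / u (a * b)) {p : (G × A) × (G × A)}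
    (h₁ : InShiftedOrbit ξ₀ s p.1.2) (h₂ : InShiftedOrbit ξ₀ s p.2.2)
    (h₃ : InShiftedOrbit ξ₀ s (p.2.1 • p.1.2)) (h₄ : InShiftedOrbit ξ₀ s (p.2.1⁻¹ • p.2.2))
    {a : G × A → Circle} (ha : ∀ x, a x = u (s (ξ₀ * x.2)) / u (s (ξ₀ * x.1⁻¹ • x.2))) :
    orbitCocycle ξ₀ s ω p =
      a p.1 * a p.2 / (a (orbitPentagon ξ₀ s p).1 * a (orbitPentagon ξ₀ s p).2) := by
  obtain ⟨⟨q₁, ξ₁⟩, ⟨q₂, ξ₂⟩⟩ := p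
  dsimp only at h₁ h₂ h₃ h₄
  rw [orbitPentagon_eq hs h₃]
  have e₁ := orbitInverse_shift_smul_div hs h₁ h₄
  have e₂ := orbitInverse_shift_smul_div hs h₃ h₂
  have e₃ : (s (ξ₀ * ξ₁))⁻¹ • q₂⁻¹ • (ξ₂ / q₂ • ξ₁) = (s (ξ₀ * ξ₁))⁻¹ • (q₂⁻¹ • ξ₂ / ξ₁) := by
    rw [smul_div', inv_smul_smul]
  simp only [orbitCocycle, orbitCochain, ha, hω, e₂, mul_inv_rev, inv_inv, mul_inv_cancel_left,
    mul_smul, smul_inv_smul, inv_smul_smul, e₃, e₁]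
  apply Additive.ofMul.injective
  simp only [ofMul_mul, ofMul_inv, ofMul_div]
  abel

/-- The points at which the cochain returns ω itself. -/
theorem orbitCochain_smul_sub (hs : ∀ g : G, s (g • ξ₀) = g) (x y : G) :
    orbitCochain ξ₀ s ω (x • ξ₀ / ξ₀) ((x * y) • ξ₀ / ξ₀) = ω (x, y) := by
  simp only [orbitCochain, mul_div_cancel, hs, inv_mul_cancel_left]

theorem inv_smul_orbitPentagon (p : (G × A) × (G × A)) :
    (orbitPentagon ξ₀ s p).2.1⁻¹ • (orbitPentagon ξ₀ s p).2.2 =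
      (s (ξ₀ * p.1.2))⁻¹ • (p.2.1⁻¹ • p.2.2 / p.1.2) := by
  simp only [orbitPentagon, mul_inv_rev, inv_inv, mul_smul, smul_inv_smul]

theorem orbitCocycle_mul (ω ω' : G × G → Circle) :
    orbitCocycle ξ₀ s (ω * ω') = orbitCocycle ξ₀ s ω * orbitCocycle ξ₀ s ω' := by
  funext p
  simp only [orbitCocycle, orbitCochain, Pi.mul_apply, mul_inv]
  exact mul_mul_mul_comm _ _ _ _

end Algebra
end FreeOrbit

/-! ### Free conull orbits: the cocycles Θ_ω and their coboundaries. -/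

section FreeOrbit

variable {G A : Type*} [Group G] [CommGroup A] [MulDistribMulAction G A]
  [MeasurableSpace G] [MeasurableSpace A]

/-- The orbit of `ξ₀` is free and conull, `s` inverts the orbit map `g ↦ g • ξ₀`, and all these
maps preserve null sets. -/
structure IsFreeOrbit (μ : Measure G) (ν : Measure A) (ξ₀ : A) (s : A → G) : Prop where
  smul : ∀ g : G, QuasiMeasurePreserving (fun ξ : A => g • ξ) ν ν
  orbit : QuasiMeasurePreserving (fun g : G => g • ξ₀) μ ν
  inverse : QuasiMeasurePreserving s ν μ
  inverse_smul : ∀ g : G, s (g • ξ₀) = g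
  smul_inverse : ∀ᵐ ξ ∂ν, s ξ • ξ₀ = ξ

variable [MeasurableMul₂ G] [MeasurableInv G] [MeasurableMul₂ A] [MeasurableInv A]
  [MeasurableSMul₂ G A]
  {μ : Measure G} {ν : Measure A} [SFinite μ] [SFinite ν]
  [μ.IsMulLeftInvariant] [ν.IsMulLeftInvariant] {ξ₀ : A} {s : A → G} {ω : G × G → Circle}

theorem measurable_orbitCochain (hs : Measurable s) (hω : Measurable ω) :
    Measurable fun p : A × A => orbitCochain ξ₀ s ω p.1 p.2 := by
  unfold orbitCochain
  fun_prop

theorem measurable_orbitPentagon (hs : Measurable s) : Measurable (orbitPentagon ξ₀ s) := by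
  unfold orbitPentagon
  fun_prop

theorem measurable_orbitCocycle (hs : Measurable s) (hω : Measurable ω) :
    Measurable (orbitCocycle ξ₀ s ω) := by
  unfold orbitCocycle orbitCochain
  fun_prop

namespace IsFreeOrbit

variable (h : IsFreeOrbit μ ν ξ₀ s)
include h

theorem measurable_inverse : Measurable s := h.inverse.measurable

theorem ae_inShiftedOrbit : ∀ᵐ ξ ∂ν, InShiftedOrbit ξ₀ s ξ :=
  (measurePreserving_mul_left ν ξ₀).quasiMeasurePreserving.ae h.smul_inverse

theorem shift : QuasiMeasurePreserving (fun ξ => s (ξ₀ * ξ)) ν μ :=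
  h.inverse.comp (measurePreserving_mul_left ν ξ₀).quasiMeasurePreserving

theorem inv_smul_prod : QuasiMeasurePreserving (fun p : G × A => p.1⁻¹ • p.2) (μ.prod ν) ν :=
  MeasureTheory.QuasiMeasurePreserving.prod_of_right (by fun_prop) (.of_forall fun g => h.smul g⁻¹)

theorem isPentagonalCocycle (hω : ω ∈ groupZ2 G) :
    IsPentagonalCocycle (μ.prod ν) (orbitPentagon ξ₀ s) (orbitCocycle ξ₀ s ω) := by
  refine ⟨measurable_orbitCocycle h.measurable_inverse hω.1, ?_⟩
  have hg := h.ae_inShiftedOrbit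
  have q₁ : QuasiMeasurePreserving (fun t : (G × A) × (G × A) × (G × A) => t.2.1.1 • t.1.2)
      ((μ.prod ν).prod ((μ.prod ν).prod (μ.prod ν))) ν :=
    MeasureTheory.QuasiMeasurePreserving.prod_of_left (by fun_prop) (.of_forall fun y => (h.smul y.1.1).comp quasiMeasurePreserving_snd)
  have q₄ : QuasiMeasurePreserving
      (fun t : (G × A) × (G × A) × (G × A) => t.2.2.1 • t.2.1.1 • t.1.2)
      ((μ.prod ν).prod ((μ.prod ν).prod (μ.prod ν))) ν :=
    MeasureTheory.QuasiMeasurePreserving.prod_of_left (by fun_prop) (.of_forall fun y =>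
      (h.smul y.2.1).comp ((h.smul y.1.1).comp quasiMeasurePreserving_snd))
  have q₅ : QuasiMeasurePreserving (fun t : (G × A) × (G × A) × (G × A) => t.2.2.1 • t.2.1.2)
      ((μ.prod ν).prod ((μ.prod ν).prod (μ.prod ν))) ν :=
    QuasiMeasurePreserving.comp (g := fun y : (G × A) × (G × A) => y.2.1 • y.1.2)
      (MeasureTheory.QuasiMeasurePreserving.prod_of_left (by fun_prop) (.of_forall fun y =>
        (h.smul y.1).comp quasiMeasurePreserving_snd)) quasiMeasurePreserving_snd
  have p₂ : QuasiMeasurePreserving (fun t : (G × A) × (G × A) × (G × A) => t.2.1)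
      ((μ.prod ν).prod ((μ.prod ν).prod (μ.prod ν))) (μ.prod ν) :=
    quasiMeasurePreserving_fst.comp quasiMeasurePreserving_snd
  have p₃ : QuasiMeasurePreserving (fun t : (G × A) × (G × A) × (G × A) => t.2.2)
      ((μ.prod ν).prod ((μ.prod ν).prod (μ.prod ν))) (μ.prod ν) :=
    quasiMeasurePreserving_snd.comp quasiMeasurePreserving_snd
  filter_upwards [q₁.ae hg, (quasiMeasurePreserving_snd.comp p₂).ae hg,
    (h.inv_smul_prod.comp p₃).ae hg, q₄.ae hg, q₅.ae hg,
    (quasiMeasurePreserving_snd.comp p₃).ae hg] with t g₁ g₂ g₃ g₄ g₅ g₆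
  exact orbitCocycle_pentagon h.inverse_smul hω.2 g₁ g₂ g₃ g₄ g₅ g₆

theorem orbitCocycle_eq_coboundary {u : G → Circle}
    (hω : ∀ a b : G, ω (a, b) = u a * u b / u (a * b)) {a : G × A → Circle}
    (ha : ∀ x, a x = u (s (ξ₀ * x.2)) / u (s (ξ₀ * x.1⁻¹ • x.2))) :
    ∀ᵐ p ∂((μ.prod ν).prod (μ.prod ν)), orbitCocycle ξ₀ s ω p =
      a p.1 * a p.2 / (a (orbitPentagon ξ₀ s p).1 * a (orbitPentagon ξ₀ s p).2) := by
  have hg := h.ae_inShiftedOrbit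
  have q : QuasiMeasurePreserving (fun p : (G × A) × (G × A) => p.2.1 • p.1.2)
      ((μ.prod ν).prod (μ.prod ν)) ν :=
    MeasureTheory.QuasiMeasurePreserving.prod_of_left (by fun_prop) (.of_forall fun y => (h.smul y.1).comp quasiMeasurePreserving_snd)
  filter_upwards [(quasiMeasurePreserving_snd.comp quasiMeasurePreserving_fst).ae hg,
    (quasiMeasurePreserving_snd.comp quasiMeasurePreserving_snd).ae hg, q.ae hg,
    (h.inv_smul_prod.comp quasiMeasurePreserving_snd).ae hg] with p g₁ g₂ g₃ g₄
  exact orbitCocycle_coboundary h.inverse_smul hω g₁ g₂ g₃ g₄ ha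

theorem orbitCocycle_mem_pentagonalB2 (hω : ω ∈ groupB2 G) :
    orbitCocycle ξ₀ s ω ∈ pentagonalB2 (μ.prod ν) (orbitPentagon ξ₀ s) := by
  obtain ⟨u, hu, hω⟩ := hω
  have hs := h.measurable_inverse
  let a : G × A → Circle := fun x => u (s (ξ₀ * x.2)) / u (s (ξ₀ * x.1⁻¹ • x.2))
  have ha : Measurable a :=
    (hu.comp (hs.comp (by fun_prop))).div (hu.comp (hs.comp (by fun_prop)))
  exact ⟨a, ha, h.orbitCocycle_eq_coboundary hω fun _ => rfl⟩

theorem orbitPentagon_fst :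
    QuasiMeasurePreserving (fun p => (orbitPentagon ξ₀ s p).1)
      ((μ.prod ν).prod (μ.prod ν)) (μ.prod ν) := by
  have hm := (measurable_orbitPentagon (ξ₀ := ξ₀) h.measurable_inverse).fst
  refine MeasureTheory.QuasiMeasurePreserving.prod_of_left hm (.of_forall fun y => ?_)
  exact MeasureTheory.QuasiMeasurePreserving.prodMap
    (measurePreserving_mul_left μ y.1).quasiMeasurePreserving (h.smul y.1)

theorem orbitPentagon_snd :
    QuasiMeasurePreserving (fun p => (orbitPentagon ξ₀ s p).2)
      ((μ.prod ν).prod (μ.prod ν)) (μ.prod ν) := by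
  have hm := (measurable_orbitPentagon (ξ₀ := ξ₀) h.measurable_inverse).snd
  have hs := h.measurable_inverse
  -- With (q₁, ξ₁) fixed, the group component depends on q₂ alone, and each q₂ acts on ξ₂ by
  -- translations and automorphisms: a skew product.
  refine MeasureTheory.QuasiMeasurePreserving.prod_of_right hm (.of_forall fun x => ?_)
  refine quasiMeasurePreserving_skew
    (f := fun q : G => (s (q⁻¹ • ξ₀ * x.2))⁻¹ * s (ξ₀ * x.2))
    (g := fun (q : G) (ξ : A) => (s (q⁻¹ • ξ₀ * x.2))⁻¹ • (q⁻¹ • ξ / x.2)) ?_ (by fun_prop) ?_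
  · exact (quasiMeasurePreserving_mul_right μ _).comp ((quasiMeasurePreserving_inv μ).comp
      (h.inverse.comp ((quasiMeasurePreserving_mul_right ν x.2).comp
        (h.orbit.comp (quasiMeasurePreserving_inv μ)))))
  · intro q
    simp only [div_eq_mul_inv]
    exact (h.smul _).comp ((quasiMeasurePreserving_mul_right ν x.2⁻¹).comp (h.smul _))

end IsFreeOrbit

end FreeOrbit

/-! ### Triviality of Θ_ω forces triviality of ω. -/

section FreeOrbit

variable {G A : Type*} [Group G] [CommGroup A] [MulDistribMulAction G A]
  [MeasurableSpace G] [MeasurableSpace A]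
  [MeasurableMul₂ G] [MeasurableInv G] [MeasurableMul₂ A] [MeasurableInv A]
  [MeasurableSMul₂ G A]
  {μ : Measure G} {ν : Measure A} [SFinite μ] [SFinite ν]
  [μ.IsMulLeftInvariant] [ν.IsMulLeftInvariant] [NeZero μ] [NeZero ν]
  {ξ₀ : A} {s : A → G} {ω : G × G → Circle}

namespace IsFreeOrbit

variable (h : IsFreeOrbit μ ν ξ₀ s)
include h

/-- For one generic g, the values E(xξ, xη) and E(ξ, η) both equal C(g⁻¹ξ, g⁻¹η): write x as (xg)g⁻¹
and 1 as gg⁻¹. -/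
theorem smul_eq_of_ae_smul_eq {E C : A → A → Circle}
    (H : ∀ᵐ p ∂(μ.prod (ν.prod ν)), E (p.1 • p.2.1) (p.1 • p.2.2) = C p.2.1 p.2.2) :
    ∀ᵐ p ∂(μ.prod (ν.prod ν)), E (p.1 • p.2.1) (p.1 • p.2.2) = E p.2.1 p.2.2 := by
  obtain ⟨g, hg⟩ := (ae_ae_of_ae_prod H).exists
  have q : QuasiMeasurePreserving
      (Prod.map (fun x : G => x * g) (Prod.map (fun ξ : A => g⁻¹ • ξ) (fun ξ : A => g⁻¹ • ξ)))
      (μ.prod (ν.prod ν)) (μ.prod (ν.prod ν)) :=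
    MeasureTheory.QuasiMeasurePreserving.prodMap (quasiMeasurePreserving_mul_right μ g)
      (MeasureTheory.QuasiMeasurePreserving.prodMap (h.smul g⁻¹) (h.smul g⁻¹))
  filter_upwards [q.ae H, q.ae (quasiMeasurePreserving_snd.ae hg)] with p e₁ e₂
  simp only [Prod.map_fst, Prod.map_snd, mul_smul, smul_inv_smul] at e₁ e₂
  rw [e₁, e₂]

theorem exists_factorization {a : G × A → Circle} (ha : Measurable a)
    {R : A × (G × A) → Circle} (hR : Measurable R)
    (H : ∀ᵐ p ∂((μ.prod ν).prod (μ.prod ν)),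
      a p.1 = a (p.2.1 * p.1.1, p.2.1 • p.1.2) * R (p.1.2, p.2)) :
    ∃ f g : G → Circle, Measurable f ∧ Measurable g ∧
      ∀ᵐ x ∂(μ.prod ν), a x = f ((s x.2)⁻¹ * x.1) * g (s x.2) := by
  -- Substitute q₁ = pt, ξ₁ = pξ₀ and q₂ = xp⁻¹: the hypothesis becomes a(pt, pξ₀) = a(xt, xξ₀)
  -- R(pξ₀, (xp⁻¹, η)). Freezing generic x and η separates t from p.
  have q₁ : QuasiMeasurePreserving (fun r : G × G => (r.2 * r.1, r.2 • ξ₀))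
      (μ.prod μ) (μ.prod ν) :=
    quasiMeasurePreserving_skew_left (g := fun t p : G => p * t) h.orbit (by fun_prop)
      fun p => (measurePreserving_mul_left μ p).quasiMeasurePreserving
  have q₂ : QuasiMeasurePreserving
      (fun z : (G × G) × (G × A) =>
        ((z.1.2 * z.1.1, z.1.2 • ξ₀), (z.2.1 * z.1.2⁻¹, z.2.2)))
      ((μ.prod μ).prod (μ.prod ν)) ((μ.prod ν).prod (μ.prod ν)) :=
    quasiMeasurePreserving_skew (g := fun (r : G × G) (y : G × A) => (y.1 * r.2⁻¹, y.2)) q₁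
      (by fun_prop) fun r => MeasureTheory.QuasiMeasurePreserving.prodMap
        (quasiMeasurePreserving_mul_right μ _) (QuasiMeasurePreserving.id ν)
  obtain ⟨x₀, hx₀⟩ := (ae_ae_of_ae_prod
    (ae_ae_of_ae_prod ((q₂.comp quasiMeasurePreserving_swap).ae H))).exists
  obtain ⟨η₀, hy⟩ := hx₀.exists
  refine ⟨fun t => a (x₀ * t, x₀ • ξ₀), fun p => R (p • ξ₀, (x₀ * p⁻¹, η₀)),
    ha.comp (by fun_prop), hR.comp (by fun_prop), ?_⟩
  have q₃ : QuasiMeasurePreserving (fun x : G × A => ((s x.2)⁻¹ * x.1, s x.2))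
      (μ.prod ν) (μ.prod μ) :=
    have hs := h.measurable_inverse
    quasiMeasurePreserving_skew_left (g := fun (q : G) (ξ : A) => (s ξ)⁻¹ * q) h.inverse
      (by fun_prop) fun ξ => (measurePreserving_mul_left μ _).quasiMeasurePreserving
  filter_upwards [q₃.ae hy, quasiMeasurePreserving_snd.ae h.smul_inverse] with x e₁ e₂
  have e₃ : (s x.2)⁻¹ • x.2 = ξ₀ := inv_smul_eq_iff.2 e₂.symm
  simpa [mul_smul, mul_assoc, e₂, e₃] using e₁

theorem orbitCochain_smul_of_coboundary {a : G × A → Circle} {j : A → Circle}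
    (hj : ∀ᵐ x ∂(μ.prod ν), a x = j (x.1⁻¹ • x.2))
    (H : ∀ᵐ p ∂((μ.prod ν).prod (μ.prod ν)), orbitCocycle ξ₀ s ω p =
      a p.1 * a p.2 / (a (orbitPentagon ξ₀ s p).1 * a (orbitPentagon ξ₀ s p).2)) :
    ∀ᵐ p ∂(μ.prod (ν.prod ν)), orbitCochain ξ₀ s ω (p.1 • p.2.1) (p.1 • p.2.2) =
      orbitCochain ξ₀ s ω p.2.1 p.2.2 *
        (j ((s (ξ₀ * p.2.1))⁻¹ • (p.2.2 / p.2.1)) / j p.2.2) := by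
  have H' : ∀ᵐ p ∂((μ.prod ν).prod (μ.prod ν)),
      orbitCochain ξ₀ s ω (p.2.1 • p.1.2) p.2.2 =
        orbitCochain ξ₀ s ω p.1.2 (p.2.1⁻¹ • p.2.2) *
          (j ((s (ξ₀ * p.1.2))⁻¹ • (p.2.1⁻¹ • p.2.2 / p.1.2)) / j (p.2.1⁻¹ • p.2.2)) := by
    filter_upwards [H, quasiMeasurePreserving_fst.ae hj, quasiMeasurePreserving_snd.ae hj,
      h.orbitPentagon_fst.ae hj, h.orbitPentagon_snd.ae hj] with p e e₁ e₂ e₃ e₄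
    rw [inv_smul_orbitPentagon] at e₄
    have e₅ : (orbitPentagon ξ₀ s p).1.1⁻¹ • (orbitPentagon ξ₀ s p).1.2 = p.1.1⁻¹ • p.1.2 := by
      simp only [orbitPentagon, mul_inv_rev, mul_smul, inv_smul_smul]
    rw [e₁, e₂, e₃, e₄, e₅, orbitCocycle, ← div_eq_mul_inv, mul_div_mul_left_eq_div,
      div_eq_div_iff_mul_eq_mul] at e
    rw [← mul_div_assoc, eq_div_iff_mul_eq', e, mul_comm]
  -- Substitute ξ₂ = q₂η; the variable q₁ no longer occurs and is then frozen.
  have q : QuasiMeasurePreserving (fun z : (G × A) × (G × A) => (z.1, (z.2.1, z.2.1 • z.2.2)))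
      ((μ.prod ν).prod (μ.prod ν)) ((μ.prod ν).prod (μ.prod ν)) :=
    MeasureTheory.QuasiMeasurePreserving.prodMap (QuasiMeasurePreserving.id _)
      (quasiMeasurePreserving_skew (g := fun (q : G) (ξ : A) => q • ξ)
        (QuasiMeasurePreserving.id μ) (by fun_prop) h.smul)
  have r : QuasiMeasurePreserving
      (fun z : G × (G × (A × A)) => ((z.1, z.2.2.1), (z.2.1, z.2.2.2)))
      (μ.prod (μ.prod (ν.prod ν))) ((μ.prod ν).prod (μ.prod ν)) :=
    ((measurePreserving_prodAssoc μ ν (μ.prod ν)).symm _).quasiMeasurePreserving.comp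
      (MeasureTheory.QuasiMeasurePreserving.prodMap (QuasiMeasurePreserving.id μ)
        quasiMeasurePreserving_leftComm)
  obtain ⟨t, ht⟩ := (ae_ae_of_ae_prod ((q.comp r).ae H')).exists
  filter_upwards [ht] with p e
  simpa using e

theorem mem_groupB2_of_smul_eq (hω : ω ∈ groupZ2 G)
    (H : ∀ᵐ p ∂(μ.prod (ν.prod ν)), orbitCochain ξ₀ s ω (p.1 • p.2.1) (p.1 • p.2.2) =
      orbitCochain ξ₀ s ω p.2.1 p.2.2) : ω ∈ groupB2 G := by
  have hs := h.measurable_inverse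
  have hg := h.ae_inShiftedOrbit
  -- translation invariance
  have T : ∀ᵐ p ∂(ν.prod (ν.prod ν)),
      orbitCochain ξ₀ s ω p.1 p.2.1 * orbitCochain ξ₀ s ω p.2.1 p.2.2 =
        orbitCochain ξ₀ s ω (p.2.1 / p.1) (p.2.2 / p.1) * orbitCochain ξ₀ s ω p.1 p.2.2 := by
    have q : QuasiMeasurePreserving
        (fun p : A × (A × A) => ((s (ξ₀ * p.1))⁻¹, (p.2.1 / p.1, p.2.2 / p.1)))
        (ν.prod (ν.prod ν)) (μ.prod (ν.prod ν)) := by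
      have hd : ∀ α : A, QuasiMeasurePreserving (fun β : A => β / α) ν ν := fun α => by
        simp only [div_eq_mul_inv]
        exact quasiMeasurePreserving_mul_right ν α⁻¹
      exact quasiMeasurePreserving_skew (f := fun α : A => (s (ξ₀ * α))⁻¹)
        (g := fun (α : A) (p : A × A) => (p.1 / α, p.2 / α))
        ((quasiMeasurePreserving_inv μ).comp h.shift) (by fun_prop)
        fun α => MeasureTheory.QuasiMeasurePreserving.prodMap (hd α) (hd α)
    filter_upwards [q.ae H, quasiMeasurePreserving_fst.ae hg,
      (quasiMeasurePreserving_fst.comp quasiMeasurePreserving_snd).ae hg,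
      (quasiMeasurePreserving_snd.comp quasiMeasurePreserving_snd).ae hg] with p e g₁ g₂ g₃
    have := orbitCochain_mul h.inverse_smul hω.2 g₁ g₂ g₃
    simp only [Function.comp_apply] at this
    rw [this, e]
  -- on the orbit, the cochain only depends on the quotient
  let N : G → G → Circle := fun x t => orbitCochain ξ₀ s ω (x • ξ₀) ((x * t) • ξ₀)
  have q₁ : QuasiMeasurePreserving (fun r : G × G => (r.1 • ξ₀, (r.1 * r.2) • ξ₀))
      (μ.prod μ) (ν.prod ν) :=
    quasiMeasurePreserving_skew (g := fun x t : G => (x * t) • ξ₀) h.orbit (by fun_prop)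
      fun x => h.orbit.comp (measurePreserving_mul_left μ x).quasiMeasurePreserving
  -- Invariance under x₀x⁻¹ carries (xξ₀, xtξ₀) to (x₀ξ₀, x₀tξ₀).
  obtain ⟨x₀, hx₀⟩ : ∃ x₀, ∀ᵐ r ∂(μ.prod μ), N x₀ r.2 = N r.1 r.2 := by
    have q : QuasiMeasurePreserving
        (fun z : G × (G × G) => (z.1 * z.2.1⁻¹, (z.2.1 • ξ₀, (z.2.1 * z.2.2) • ξ₀)))
        (μ.prod (μ.prod μ)) (μ.prod (ν.prod ν)) :=
      quasiMeasurePreserving_skew_left (g := fun (x : G) (r : G × G) => x * r.1⁻¹) q₁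
        (by fun_prop) fun r => quasiMeasurePreserving_mul_right μ _
    obtain ⟨x₀, hx₀⟩ := (ae_ae_of_ae_prod (q.ae H)).exists
    refine ⟨x₀, hx₀.mono fun r hr => ?_⟩
    simpa [N, smul_smul, mul_assoc] using hr
  have hNm : Measurable (N x₀) :=
    (measurable_orbitCochain (ξ₀ := ξ₀) hs hω.1).comp
      (f := fun t : G => (x₀ • ξ₀, (x₀ * t) • ξ₀)) (by fun_prop)
  refine mem_groupB2_of_ae (μ := μ) hω hNm ?_
  have qm : QuasiMeasurePreserving (fun r : G × G => (r.1, r.1 * r.2)) (μ.prod μ) (μ.prod μ) :=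
    (measurePreserving_prod_mul μ μ).quasiMeasurePreserving
  -- `(x, (s, t)) ↦ (x, (s, s t))`
  have qi : QuasiMeasurePreserving (fun z : G × (G × G) => (z.1, (z.2.1, z.2.1 * z.2.2)))
      (μ.prod (μ.prod μ)) (μ.prod (μ.prod μ)) :=
    MeasureTheory.QuasiMeasurePreserving.prodMap (QuasiMeasurePreserving.id μ) qm
  have qT : QuasiMeasurePreserving
      (fun z : G × (G × G) => (z.1 • ξ₀, ((z.1 * z.2.1) • ξ₀, (z.1 * (z.2.1 * z.2.2)) • ξ₀)))
      (μ.prod (μ.prod μ)) (ν.prod (ν.prod ν)) :=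
    (quasiMeasurePreserving_skew
      (g := fun (x : G) (r : G × G) => ((x * r.1) • ξ₀, (x * r.2) • ξ₀)) h.orbit (by fun_prop)
      fun x => MeasureTheory.QuasiMeasurePreserving.prodMap
        (h.orbit.comp (measurePreserving_mul_left μ x).quasiMeasurePreserving)
        (h.orbit.comp (measurePreserving_mul_left μ x).quasiMeasurePreserving)).comp qi
  have hd : QuasiMeasurePreserving (fun x : G => x • ξ₀ / ξ₀) μ ν := by
    simp only [div_eq_mul_inv]
    exact (quasiMeasurePreserving_mul_right ν ξ₀⁻¹).comp h.orbit
  have qH : QuasiMeasurePreserving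
      (fun z : G × (G × G) => (z.1, (z.2.1 • ξ₀ / ξ₀, (z.2.1 * z.2.2) • ξ₀ / ξ₀)))
      (μ.prod (μ.prod μ)) (μ.prod (ν.prod ν)) :=
    (MeasureTheory.QuasiMeasurePreserving.prodMap (QuasiMeasurePreserving.id μ)
      (MeasureTheory.QuasiMeasurePreserving.prodMap hd hd)).comp qi
  have p₁ : QuasiMeasurePreserving (fun z : G × (G × G) => (z.1, z.2.1))
      (μ.prod (μ.prod μ)) (μ.prod μ) :=
    MeasureTheory.QuasiMeasurePreserving.prodMap (QuasiMeasurePreserving.id μ)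
      quasiMeasurePreserving_fst
  have p₃ : QuasiMeasurePreserving (fun z : G × (G × G) => (z.1, z.2.2))
      (μ.prod (μ.prod μ)) (μ.prod μ) :=
    MeasureTheory.QuasiMeasurePreserving.prodMap (QuasiMeasurePreserving.id μ)
      quasiMeasurePreserving_snd
  have p₂ : QuasiMeasurePreserving (fun z : G × (G × G) => (z.1 * z.2.1, z.2.2))
      (μ.prod (μ.prod μ)) (μ.prod μ) :=
    quasiMeasurePreserving_snd.comp
      ((quasiMeasurePreserving_skew (g := fun (x : G) (r : G × G) => (x * r.1, r.2))
        (QuasiMeasurePreserving.id μ) (by fun_prop) fun x =>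
          MeasureTheory.QuasiMeasurePreserving.prodMap
            (measurePreserving_mul_left μ x).quasiMeasurePreserving (QuasiMeasurePreserving.id μ)))
  -- The identity T at xξ₀, xpξ₀, xptξ₀ contains F(x(pξ₀/ξ₀), x(ptξ₀/ξ₀)), which equals ω(p, t) by
  -- invariance.
  have key : ∀ᵐ z ∂(μ.prod (μ.prod μ)),
      ω z.2 = N x₀ z.2.1 * N x₀ z.2.2 / N x₀ (z.2.1 * z.2.2) := by
    filter_upwards [qT.ae T, qH.ae H, p₁.ae hx₀, p₂.ae hx₀, (p₃.comp qi).ae hx₀]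
      with z e₁ e₂ e₃ e₄ e₅
    rw [orbitCochain_smul_sub h.inverse_smul, smul_div', smul_div', smul_smul, smul_smul] at e₂
    simp only [Function.comp_apply] at e₅
    rw [e₃, e₄, e₅, eq_div_iff_mul_eq', ← e₂, mul_comm]
    simp only [N, mul_assoc]
    exact (mul_comm _ _).trans e₁.symm
  exact (ae_ae_of_ae_prod key).exists.choose_spec

theorem mem_groupB2_of_orbitCocycle_mem (hω : ω ∈ groupZ2 G)
    (hΘ : orbitCocycle ξ₀ s ω ∈ pentagonalB2 (μ.prod ν) (orbitPentagon ξ₀ s)) :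
    ω ∈ groupB2 G := by
  have hs := h.measurable_inverse
  obtain ⟨a, ha, H⟩ := hΘ
  -- Any value of q₁ would do here, as Θ_ω and the second leg of w do not involve it.
  let R : A × (G × A) → Circle := fun z =>
    orbitCocycle ξ₀ s ω ((1, z.1), z.2) * a (orbitPentagon ξ₀ s ((1, z.1), z.2)).2 / a z.2
  have hR : Measurable R := by
    have hm : Measurable fun z : A × (G × A) => (((1 : G), z.1), z.2) := by fun_prop
    exact (((measurable_orbitCocycle hs hω.1).comp hm).mul
      (ha.comp ((measurable_orbitPentagon (ξ₀ := ξ₀) hs).comp hm).snd)).div (ha.comp measurable_snd)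
  obtain ⟨f, g, hf, hg, hfg⟩ := h.exists_factorization ha hR (by
    filter_upwards [H] with p hp
    have e₁ : orbitCocycle ξ₀ s ω ((1, p.1.2), p.2) = orbitCocycle ξ₀ s ω p := rfl
    have e₂ : (orbitPentagon ξ₀ s ((1, p.1.2), p.2)).2 = (orbitPentagon ξ₀ s p).2 := rfl
    have e₃ : (p.2.1 * p.1.1, p.2.1 • p.1.2) = (orbitPentagon ξ₀ s p).1 := rfl
    simp only [R, e₁, e₂, e₃, hp]
    apply Additive.ofMul.injective
    simp only [ofMul_mul, ofMul_div]
    abel)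
  -- Chosen so that u(s(ξ₀ξ)) = g(s(ξ)): the numerator of b then cancels the factor g in a, and the
  -- rest depends only on q⁻¹ξ.
  let u : G → Circle := fun x => g (s (x • ξ₀ / ξ₀))
  have hu : Measurable u := hg.comp (hs.comp (by fun_prop))
  let θ : G × G → Circle := fun p => u p.1 * u p.2 / u (p.1 * p.2)
  have hθ : θ ∈ groupB2 G := ⟨u, hu, fun _ _ => rfl⟩
  let b : G × A → Circle := fun x => u (s (ξ₀ * x.2)) / u (s (ξ₀ * x.1⁻¹ • x.2))
  have Hb := h.orbitCocycle_eq_coboundary (u := u) (ω := θ) (fun _ _ => rfl) (a := b) fun _ => rfl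
  let j : A → Circle := fun ξ => f (s ξ)⁻¹ * u (s (ξ₀ * ξ))
  have hj : ∀ᵐ x ∂(μ.prod ν), a x / b x = j (x.1⁻¹ • x.2) := by
    filter_upwards [hfg, quasiMeasurePreserving_snd.ae h.smul_inverse,
      quasiMeasurePreserving_snd.ae h.ae_inShiftedOrbit] with x e e₁ e₂
    have e₃ : u (s (ξ₀ * x.2)) = g (s x.2) := by
      simp only [u]
      rw [e₂, mul_div_cancel_left]
    simp only [j, b, e, e₃, orbitInverse_smul h.inverse_smul _ e₁, mul_inv_rev, inv_inv]
    apply Additive.ofMul.injective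
    simp only [ofMul_mul, ofMul_div]
    abel
  have hω' : ω / θ ∈ groupZ2 G := (groupZ2 G).div_mem hω (groupB2_le_groupZ2 hθ)
  have H' : ∀ᵐ p ∂((μ.prod ν).prod (μ.prod ν)), orbitCocycle ξ₀ s (ω / θ) p =
      (a p.1 / b p.1) * (a p.2 / b p.2) / ((a (orbitPentagon ξ₀ s p).1 /
        b (orbitPentagon ξ₀ s p).1) * (a (orbitPentagon ξ₀ s p).2 /
          b (orbitPentagon ξ₀ s p).2)) := by
    filter_upwards [H, Hb] with p e e'
    have := congrFun (orbitCocycle_mul (ξ₀ := ξ₀) (s := s) (ω / θ) θ) p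
    rw [div_mul_cancel, Pi.mul_apply, e, e', ← div_eq_iff_eq_mul] at this
    rw [← this]
    apply Additive.ofMul.injective
    simp only [ofMul_mul, ofMul_div]
    abel
  have := h.mem_groupB2_of_smul_eq hω' (h.smul_eq_of_ae_smul_eq
    (C := fun ξ η => orbitCochain ξ₀ s (ω / θ) ξ η * (j ((s (ξ₀ * ξ))⁻¹ • (η / ξ)) / j η))
    (h.orbitCochain_smul_of_coboundary (a := fun x => a x / b x) hj H'))
  simpa using (groupB2 G).mul_mem this hθ

end IsFreeOrbit

end FreeOrbit

/-! ### The action of Q on the dual of V. -/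

section DualAction

variable {V : Type*} [CommGroup V] [TopologicalSpace V]

/-- The action of a group of automorphisms of `V` on the dual of `V`. -/
noncomputable instance dualMulDistribMulAction (Q : Subgroup (V ≃ₜ* V)) :
    MulDistribMulAction Q (PontryaginDual V) where
  smul q ξ := dualAct (q : V ≃ₜ* V) ξ
  one_smul _ := rfl
  mul_smul _ _ _ := rfl
  smul_one _ := rfl
  smul_mul _ _ _ := rfl

variable [LocallyCompactSpace V]

instance autSubgroup_secondCountable [SecondCountableTopology V] (Q : Subgroup (V ≃ₜ* V)) :
    SecondCountableTopology Q :=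
  TopologicalSpace.Subtype.secondCountableTopology (Q : Set (V ≃ₜ* V))

instance dual_secondCountable [SecondCountableTopology V] :
    SecondCountableTopology (PontryaginDual V) :=
  (ContinuousMonoidHom.isInducing_toContinuousMap V Circle).secondCountableTopology

theorem continuous_dualAct :
    Continuous fun p : (V ≃ₜ* V) × PontryaginDual V => dualAct p.1 p.2 := by
  have hi := ContinuousMonoidHom.isInducing_toContinuousMap V Circle
  refine hi.continuous_iff.2 ?_
  have h : Continuous (autToMaps (V := V)) := continuous_induced_dom
  exact (hi.continuous.comp continuous_snd).compCM (h.snd.comp continuous_fst)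

instance dual_continuousSMul (Q : Subgroup (V ≃ₜ* V)) : ContinuousSMul Q (PontryaginDual V) :=
  ⟨continuous_dualAct.comp (continuous_subtype_val.prodMap continuous_id)⟩

theorem quasiMeasurePreserving_dual_smul [IsTopologicalGroup V] [SecondCountableTopology V] (Q : Subgroup (V ≃ₜ* V))
    (q : Q) : QuasiMeasurePreserving (fun ξ : PontryaginDual V => q • ξ) haar haar := by
  have hc : ∀ g : Q, Continuous fun ξ : PontryaginDual V => g • ξ := fun g => continuous_const_smul g
  have := (MulDistribMulAction.toMulEquiv (PontryaginDual V) q).isHaarMeasure_map haar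
    (hc q) (hc q⁻¹)
  exact ⟨(hc q).measurable, absolutelyContinuous_isHaarMeasure
    (haar.map (MulDistribMulAction.toMulEquiv (PontryaginDual V) q)) haar⟩

/-- Almost everywhere invertibility of an orbit map already makes the stabilizer trivial. With φ
injective, continuous and open, its image is open and its inverse is Borel. -/
theorem isFreeOrbit_dual [IsTopologicalGroup V] [T2Space V] [SecondCountableTopology V]
    (Q : Subgroup (V ≃ₜ* V)) [LocallyCompactSpace Q] (ξ₀ : PontryaginDual V)
    (hφ : IsMeasureClassIso (haar : Measure Q) (haar : Measure (PontryaginDual V))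
      (orbitMap Q ξ₀))
    (hopen : IsOpenMap (orbitMap Q ξ₀)) :
    IsFreeOrbit (haar : Measure Q) (haar : Measure (PontryaginDual V)) ξ₀ (orbitInv Q ξ₀) := by
  obtain ⟨hq, g, hg, hgφ, hφg⟩ := hφ
  have hinj : Function.Injective (orbitMap Q ξ₀) := by
    intro x y hxy
    -- The element x⁻¹y fixes ξ₀, so φ takes the same value at z and zx⁻¹y; for generic z, g
    -- recovers both points from that value.
    obtain ⟨z, h₁, h₂⟩ :=
      (hgφ.and ((quasiMeasurePreserving_mul_right haar (x⁻¹ * y)).ae hgφ)).exists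
    have e : orbitMap Q ξ₀ (z * (x⁻¹ * y)) = orbitMap Q ξ₀ z := by
      change (z * (x⁻¹ * y)) • ξ₀ = z • ξ₀
      rw [mul_smul, mul_smul, show y • ξ₀ = x • ξ₀ from hxy.symm, inv_smul_smul]
    simp only [Function.comp_apply, id_eq, e] at h₁ h₂
    rw [h₁, left_eq_mul, inv_mul_eq_one] at h₂
    exact h₂
  have hcont : Continuous (orbitMap Q ξ₀) := continuous_id.smul continuous_const
  have hemb := (Topology.IsOpenEmbedding.of_continuous_injective_isOpenMap hcont hinj
    hopen).measurableEmbedding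
  have hleft : ∀ q, orbitInv Q ξ₀ (orbitMap Q ξ₀ q) = q := Function.leftInverse_invFun hinj
  have hgs : g =ᵐ[haar] orbitInv Q ξ₀ := by
    filter_upwards [hφg] with ξ hξ
    conv_rhs => rw [← show orbitMap Q ξ₀ (g ξ) = ξ from hξ, hleft]
  -- By definition `Function.invFun` extends the identity of Q along φ, with a constant value off
  -- the orbit.
  have hm : Measurable (orbitInv Q ξ₀) :=
    hemb.measurable_extend measurable_id (measurable_const (a := Classical.arbitrary Q))
  refine ⟨quasiMeasurePreserving_dual_smul Q, hq, ⟨hm, ?_⟩, hleft, ?_⟩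
  · rw [← Measure.map_congr hgs]
    exact hg.absolutelyContinuous
  · filter_upwards [hgs, hφg] with ξ e₁ e₂
    rw [← e₁]
    exact e₂

end DualAction

theorem mainTheorem5 {V : Type*} [CommGroup V] [TopologicalSpace V] [IsTopologicalGroup V]
    [LocallyCompactSpace V] [T2Space V] [SecondCountableTopology V]
    (Q : Subgroup (V ≃ₜ* V)) (hQ : IsClosed (Q : Set (V ≃ₜ* V))) [LocallyCompactSpace Q]
    (ξ₀ : PontryaginDual V)
    (hφ : IsMeasureClassIso (haar : Measure Q) (haar : Measure (PontryaginDual V))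
      (orbitMap Q ξ₀))
    (hopen : IsOpenMap (orbitMap Q ξ₀)) :
    ∃ Φ : GroupH2 Q →* PentagonalH2 (dualHaar Q) (pentagonalMap Q ξ₀),
      (∀ ω : groupZ2 Q,
        ∃ hΘ : pentagonalCocycle Q ξ₀ ω ∈ pentagonalZ2 (dualHaar Q) (pentagonalMap Q ξ₀),
          Φ (groupClass ω) = pentagonalClass ⟨pentagonalCocycle Q ξ₀ ω, hΘ⟩) ∧
      (∀ ω : groupZ2 Q, Continuous (ω : Q × Q → Circle) → Φ (groupClass ω) = 1 →
        groupClass ω = 1) ∧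
      Set.InjOn Φ {c | ∃ ω : groupZ2 Q, Continuous (ω : Q × Q → Circle) ∧ groupClass ω = c} := by
  have h := isFreeOrbit_dual Q ξ₀ hφ hopen
  have hZ : ∀ ω : groupZ2 Q,
      pentagonalCocycle Q ξ₀ ω ∈ pentagonalZ2 (dualHaar Q) (pentagonalMap Q ξ₀) :=
    -- For the dual action, `orbitCocycle` and `orbitPentagon` unfold to `pentagonalCocycle` and
    -- `pentagonalMap`.
    fun ω => h.isPentagonalCocycle ω.2
  let f : groupZ2 Q →* pentagonalZ2 (dualHaar Q) (pentagonalMap Q ξ₀) :=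
    MonoidHom.mk' (fun ω => ⟨pentagonalCocycle Q ξ₀ ω, hZ ω⟩)
      fun ω ω' => Subtype.ext (orbitCocycle_mul (ω : Q × Q → Circle) ω')
  let Φ : GroupH2 Q →* PentagonalH2 (dualHaar Q) (pentagonalMap Q ξ₀) :=
    QuotientGroup.map _ _ f fun ω hω =>
      Subgroup.mem_comap.2 (Subgroup.mem_subgroupOf.2
        (h.orbitCocycle_mem_pentagonalB2 (Subgroup.mem_subgroupOf.1 hω)))
  have hΦ : ∀ ω : groupZ2 Q, Φ (groupClass ω) = 1 → groupClass ω = 1 := fun ω hω =>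
    (QuotientGroup.eq_one_iff _).2 (Subgroup.mem_subgroupOf.2
      (h.mem_groupB2_of_orbitCocycle_mem ω.2
        (Subgroup.mem_subgroupOf.1 ((QuotientGroup.eq_one_iff (f ω)).1 hω))))
  have hinj : Function.Injective Φ :=
    (injective_iff_map_eq_one Φ).2 fun c => QuotientGroup.induction_on c hΦ
  exact ⟨Φ, fun ω => ⟨hZ ω, rfl⟩, fun ω _ => hΦ ω, hinj.injOn⟩
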